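/- **Proposition (structural equivalence is a strong bisimulation).** Terms of the linear substitution calculus are given by $t,u,w,r ::= x \mid \lambda x.t \mid t\,u \mid t[x{\leftarrow}u]$, where $\lambda x.t$ and the explicit substitution (ES) $t[x{\leftarrow}u]$ bind $x$ in $t$; terms are taken modulo $\alpha$-equivalence. Contexts are $C ::= \langle\cdot\rangle \mid \lambda x.C \mid C\,t \mid t\,C \mid C[x{\leftarrow}t] \mid t[x{\leftarrow}C]$ and substitution contexts are $L ::= \langle\cdot\rangle \mid L[x{\leftarrow}t]$. The rewriting steps, performed without capture of variables, are - multiplicative: $C\langle L\langle\lambda x.t\rangle\,u\rangle \to_{\mathtt m} C\langle L\langle t[x{\leftarrow}u]\rangle\rangle$, with position $C$; - exponential: $C\langle x\rangle \to_{\mathtt e} C\langle u\rangle$ if $C = C_1\langle C_2[x{\leftarrow}u]\rangle$ and $C_2$ does not capture $x$, with position $C$. Order contexts as follows. - $\prec_O$ is the least relation such that $\langle\cdot\rangle\prec_O C$ for $C\neq\langle\cdot\rangle$, and $C\prec_O C'$ implies $D\langle C\rangle\prec_O D\langle C'\rangle$ for every context $D$. - $\prec_L$ is the least relation such that, if $C\langle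 t_0\rangle=t$ and $C'\langle u_0\rangle=u$ for some terms $t_0,u_0$, then $C\,u\prec_L t\,C'$ and $C[x{\leftarrow}u]\prec_L t[x{\leftarrow}C']$, and such that $C\prec_L C'$ implies $D\langle C\rangle\prec_L D\langle C'\rangle$ for every context $D$. - $C\prec_{LO}C'$ if $C\prec_O C'$ or $C\prec_L C'$. Linear leftmost-outermost reduction does not go inside the arguments of ES. That is, $t\to_{LO}u$ if $t$ rewrites to $u$ by a step whose position $C$ is not inside the argument of an ES (the hole of $C$ does not lie in $u'$ for any $t'[y{\leftarrow}u']$), and $C\prec_{LO}C'$ for every other position $C'$ of a redex of $t$ that is not inside the argument of an ES. Structural equivalence $\equiv$ is the reflexive, symmetric, transitive and contextual closure of the axioms $$\begin{array}{rcll} (\lambda x.t)[y{\leftarrow}u] &\equiv& \lambda x.t[y{\leftarrow}u] & \text{if } x\notin \mathrm{fv}(u)\\ (t\,u)[x{\leftarrow}w] &\equiv& t[x{\leftarrow}w]\,u & \text{if } x\notin \mathrm{fv}(u)\\ (t\,u)[x{\leftarrow}w] &\equiv& t\,u[x{\leftarrow}w] & \text{if } x\notin \mathrm{fv}(t)\\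 t[x{\leftarrow}u][y{\leftarrow}w] &\equiv& t[y{\leftarrow}w][x{\leftarrow}u] & \text{if } y\notin \mathrm{fv}(u),\ x\notin \mathrm{fv}(w)\\ t[x{\leftarrow}u][y{\leftarrow}w] &\equiv& t[x{\leftarrow}u[y{\leftarrow}w]] & \text{if } y\notin \mathrm{fv}(t)\\ t[x{\leftarrow}u] &\equiv& t & \text{if } x\notin \mathrm{fv}(t)\\ t[x{\leftarrow}u] &\equiv& t'[x{\leftarrow}u][y{\leftarrow}u] & \end{array}$$ where in the last axiom $y$ is fresh and $t'$ is obtained from $t$ by renaming some (possibly no) occurrences of $x$ as $y$. If $t\equiv u$ and $u\to_{LO}w$, then there is a term $r$ with $t\to_{LO}r$ and $r\equiv w$, and the steps $u\to_{LO}w$ and $t\to_{LO}r$ are both multiplicative or both exponential. -/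

import Mathlib

namespace LSC

/-- Terms of the linear substitution calculus modulo alpha-equivalence, represented with de Bruijn
indices. `lam t` is the abstraction and `es t u` is the explicit substitution of `u` for the
variable `0` of `t`. Both bind the index `0` in `t`; the argument `u` of `es t u` is outside the
scope of that binder. Indices that exceed the number of enclosing binders are free variables. -/
inductive Term : Type
  | var : ℕ → Term
  | lam : Term → Term
  | app : Term → Term → Term
  | es : Term → Term → Term

/-- Extension of a renaming below one binder. -/
def liftRen (f : ℕ → ℕ) : ℕ → ℕ
  | 0 => 0
  | n + 1 => f n + 1

/-- Capture-avoiding renaming of the free variables of a term. -/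
def Term.rename : (ℕ → ℕ) → Term → Term
  | f, .var n => .var (f n)
  | f, .lam t => .lam (Term.rename (liftRen f) t)
  | f, .app t u => .app (Term.rename f t) (Term.rename f u)
  | f, .es t u => .es (Term.rename (liftRen f) t) (Term.rename f u)

/-- Weakening by `k` binders: the same term, moved below `k` further binders none of whose
variables occurs in it. The terms `t` in which the variable `0` does not occur are exactly those
of the form `Term.shift 1 s`. -/
def Term.shift (k : ℕ) (t : Term) : Term := t.rename (fun n => n + k)

/-- Exchange of the variables of the two innermost binders. -/
def swapRen : ℕ → ℕ
  | 0 => 1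
  | 1 => 0
  | n + 2 => n + 2

/-- General one-hole contexts. -/
inductive Ctx : Type
  | hole : Ctx
  | lam : Ctx → Ctx
  | appL : Ctx → Term → Ctx
  | appR : Term → Ctx → Ctx
  | esL : Ctx → Term → Ctx
  | esR : Term → Ctx → Ctx

namespace Ctx

/-- Plugging (which may capture): the term `C⟨t⟩`. -/
def plug : Ctx → Term → Term
  | hole, t => t
  | lam C, t => .lam (C.plug t)
  | appL C u, t => .app (C.plug t) u
  | appR u C, t => .app u (C.plug t)
  | esL C u, t => .es (C.plug t) u
  | esR u C, t => .es u (C.plug t)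

/-- Plugging of a context in a context: `C⟨D⟩`. -/
def comp : Ctx → Ctx → Ctx
  | hole, D => D
  | lam C, D => .lam (C.comp D)
  | appL C u, D => .appL (C.comp D) u
  | appR u C, D => .appR u (C.comp D)
  | esL C u, D => .esL (C.comp D) u
  | esR u C, D => .esR u (C.comp D)

/-- The number of binders that have the hole in their scope. -/
def depth : Ctx → ℕ
  | hole => 0
  | lam C => C.depth + 1
  | appL C _ => C.depth
  | appR _ C => C.depth
  | esL C _ => C.depth + 1
  | esR _ C => C.depth

/-- Substitution contexts `L ::= ⟨·⟩ | L[x/t]`. -/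
inductive IsSubst : Ctx → Prop
  | hole : IsSubst hole
  | esL (L : Ctx) (t : Term) : IsSubst L → IsSubst (esL L t)

/-- The hole of the context is not inside the argument of an explicit substitution. -/
def OutsideES : Ctx → Prop
  | hole => True
  | lam C => C.OutsideES
  | appL C _ => C.OutsideES
  | appR _ C => C.OutsideES
  | esL C _ => C.OutsideES
  | esR _ _ => False

/-- The prefix relation between contexts and terms. -/
def Prefix (C : Ctx) (t : Term) : Prop := ∃ u : Term, C.plug u = t

/-- The outside-in order on contexts. -/
inductive OutIn : Ctx → Ctx → Prop
  | root (C : Ctx) : C ≠ hole → OutIn hole C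
  | closure (D C C' : Ctx) : OutIn C C' → OutIn (D.comp C) (D.comp C')

/-- The left-to-right order on contexts. -/
inductive LeftRight : Ctx → Ctx → Prop
  | app (C C' : Ctx) (t u : Term) : C.Prefix t → C'.Prefix u →
      LeftRight (appL C u) (appR t C')
  | es (C C' : Ctx) (t u : Term) : C.Prefix t → C'.Prefix u →
      LeftRight (esL C u) (esR t C')
  | closure (D C C' : Ctx) : LeftRight C C' → LeftRight (D.comp C) (D.comp C')

/-- The left-to-right outside-in order on contexts. -/
def LeftOut (C C' : Ctx) : Prop := OutIn C C' ∨ LeftRight C C'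

end Ctx

/-- The two kinds of rewriting steps. -/
inductive Kind : Type
  | mul : Kind
  | exp : Kind

/-- `StepAt k C t u`: the term `t` rewrites to `u` with a step of kind `k` that reduces the redex
of position `C`.

* Multiplicative: `C⟨L⟨λx.b⟩ a⟩ → C⟨L⟨b[x/a]⟩⟩`. The argument `a` enters the scope of the binders
  of `L`, none of which may capture its variables.
* Exponential, in compact form: `C⟨x⟩ → C⟨a⟩` for `C = D⟨E[x/a]⟩`, where `E` does not capture `x`:
  the occurrence of `x` in the hole of `E` is the index `E.depth`. The term `a` enters the scope of
  `x` and of the binders of `E`, none of which may capture its variables. -/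
inductive StepAt : Kind → Ctx → Term → Term → Prop
  | mul (C L : Ctx) (b a : Term) : L.IsSubst →
      StepAt Kind.mul C
        (C.plug (.app (L.plug (.lam b)) a))
        (C.plug (L.plug (.es b (a.shift L.depth))))
  | exp (D E : Ctx) (a : Term) :
      StepAt Kind.exp (D.comp (.esL E a))
        ((D.comp (.esL E a)).plug (.var E.depth))
        ((D.comp (.esL E a)).plug (a.shift (E.depth + 1)))

/-- `C` is the position of a redex of `t` that is not inside the argument of an explicit
substitution. -/
def IsRedex (C : Ctx) (t : Term) : Prop :=
  C.OutsideES ∧ ∃ (k : Kind) (u : Term), StepAt k C t u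

/-- `C` is the leftmost-outermost redex of `t`. -/
def IsLORedex (C : Ctx) (t : Term) : Prop :=
  IsRedex C t ∧ ∀ C' : Ctx, IsRedex C' t → C' ≠ C → C.LeftOut C'

/-- Linear leftmost-outermost reduction, with the kind of the step. -/
def LOStep (k : Kind) (t u : Term) : Prop :=
  ∃ C : Ctx, IsLORedex C t ∧ StepAt k C t u

/-- The axioms of structural equivalence. A side condition that a variable does not occur in a term
is expressed by writing the term as the result of a renaming that misses the variable. -/
inductive StructAx : Term → Term → Prop
  /-- `(λx.t)[y/u] ≡ λx.t[y/u]` if `x ∉ fv(u)`. -/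
  | lam (t u : Term) :
      StructAx (.es (.lam t) u) (.lam (.es (t.rename swapRen) (u.shift 1)))
  /-- `(t u)[x/w] ≡ t[x/w] u` if `x ∉ fv(u)`. -/
  | appL (t u w : Term) :
      StructAx (.es (.app t (u.shift 1)) w) (.app (.es t w) u)
  /-- `(t u)[x/w] ≡ t u[x/w]` if `x ∉ fv(t)`. -/
  | appR (t u w : Term) :
      StructAx (.es (.app (t.shift 1) u) w) (.app t (.es u w))
  /-- `t[x/u][y/w] ≡ t[y/w][x/u]` if `y ∉ fv(u)` and `x ∉ fv(w)`. -/
  | com (t u w : Term) :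
      StructAx (.es (.es t (u.shift 1)) w) (.es (.es (t.rename swapRen) (w.shift 1)) u)
  /-- `t[x/u][y/w] ≡ t[x/u[y/w]]` if `y ∉ fv(t)`. On the left, `x` is the index `0` and `y` is
  the index `1` of the body, and the renaming misses exactly the index `1`. -/
  | comp (t u w : Term) :
      StructAx (.es (.es (t.rename (liftRen Nat.succ)) u) w) (.es t (.es u w))
  /-- `t[x/u] ≡ t` if `x ∉ fv(t)`. -/
  | gc (t u : Term) :
      StructAx (.es (t.shift 1) u) t
  /-- `t[x/u] ≡ s[x/u][y/u]` if `y` is fresh and `s` is obtained from `t` by renaming some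
  (possibly none) of the occurrences of `x` as `y`, that is, if `t` is the result of renaming `y` as
  `x` in `s`. In `s`, `x` is the index `0` and `y` is the index `1`; `Nat.pred` merges them into the
  index `0`. -/
  | dup (s u : Term) :
      StructAx (.es (s.rename Nat.pred) u) (.es (.es s (u.shift 1)) u)

/-- Structural equivalence: the reflexive, symmetric, transitive and contextual closure of the
axioms. -/
inductive StructEq : Term → Term → Prop
  | ax (t u : Term) : StructAx t u → StructEq t u
  | refl (t : Term) : StructEq t t
  | symm (t u : Term) : StructEq t u → StructEq u t
  | trans (t u w : Term) : StructEq t u → StructEq u w → StructEq t w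
  | ctx (C : Ctx) (t u : Term) : StructEq t u → StructEq (C.plug t) (C.plug u)

end LSC

namespace LSC

/-! ### Normal forms for structural equivalence

Pushing every explicit substitution to the occurrences of its variable turns a term into one whose
explicit substitutions all have the shape `x[x/u]`. Such a node is written `ptr u`. -/

/-! Structural equivalence is equality of unfoldings, and leftmost-outermost reduction is a
deterministic reduction of unfoldings. The unfolding of a term replaces each occurrence of a
variable bound by an ES with a pointer `ptr` to the unfolding of its content. Garbage, sharing and
the placement of ES are all forgotten, but a pointer still separates a pending exponential step from
one already done.

For the first claim, every axiom preserves unfoldings (`StructEq.eval_eq`). Conversely, the axioms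
suffice to push each ES to the occurrences of its variable, so a term is equivalent to the readback
of its unfolding (`StructEq.reify_eval`).

For the second, an exponential step erases one `ptr`, and a multiplicative step substitutes `ptr` of
the argument under the abstraction. Unfolding duplicates the arguments of ES, but only below `ptr`,
where neither reduction enters; hence one step of a term is exactly one step of its unfolding
(`loAt_or_normal`). Transferring a step from `u` to `t` then only requires rewriting along the
equality of the two unfoldings. -/

/-- Terms whose explicit substitutions have all been pushed to the variables; `ptr n` stands for
`x[x/n]`. -/
inductive Unf : Type
  | var : ℕ → Unf
  | lam : Unf → Unf
  | app : Unf → Unf → Unf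
  | ptr : Unf → Unf

/-! ### Environments and renamings -/

/-- Extension of a sequence by a new first element. -/
def scons {α : Type} (a : α) (f : ℕ → α) : ℕ → α
  | 0 => a
  | n + 1 => f n

theorem comp_scons {α β : Type} (g : α → β) (a : α) (f : ℕ → α) :
    (fun i => g (scons a f i)) = scons (g a) (fun i => g (f i)) := by
  funext i; cases i <;> rfl

theorem scons_liftRen {α : Type} (a : α) (f : ℕ → α) (r : ℕ → ℕ) :
    (fun i => scons a f (liftRen r i)) = scons a (fun i => f (r i)) := by
  funext i; cases i <;> rfl

theorem liftRen_comp (f g : ℕ → ℕ) :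
    (fun i => liftRen f (liftRen g i)) = liftRen (fun i => f (g i)) := by
  funext i; cases i <;> rfl

theorem liftRen_id : liftRen (fun i => i) = fun i => i := by
  funext i; cases i <;> rfl

theorem Term.rename_rename (f g : ℕ → ℕ) (t : Term) :
    (t.rename g).rename f = t.rename (fun i => f (g i)) := by
  induction t generalizing f g with
  | var n => rfl
  | lam t ih => simp only [Term.rename, ih, liftRen_comp]
  | app t u iht ihu => simp only [Term.rename, iht, ihu]
  | es t u iht ihu => simp only [Term.rename, iht, ihu, liftRen_comp]

theorem Term.rename_id (t : Term) : t.rename (fun i => i) = t := by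
  induction t with
  | var n => rfl
  | lam t ih => simp only [Term.rename, liftRen_id, ih]
  | app t u iht ihu => simp only [Term.rename, iht, ihu]
  | es t u iht ihu => simp only [Term.rename, liftRen_id, iht, ihu]

theorem Term.shift_zero (t : Term) : t.shift 0 = t := t.rename_id

theorem Term.shift_shift (t : Term) (m n : ℕ) : (t.shift m).shift n = t.shift (m + n) := by
  simp only [Term.shift, Term.rename_rename, Nat.add_assoc]

/-! ### Substitution calculus of unfoldings -/

namespace Unf

/-- Renaming of the free variables. -/
def rename : (ℕ → ℕ) → Unf → Unf
  | f, var n => var (f n)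
  | f, lam t => lam (rename (liftRen f) t)
  | f, app t u => app (rename f t) (rename f u)
  | f, ptr t => ptr (rename f t)

/-- Extension of a substitution below an abstraction. -/
def lift (s : ℕ → Unf) : ℕ → Unf := scons (var 0) (fun i => (s i).rename Nat.succ)

/-- Parallel capture-avoiding substitution. -/
def subst : (ℕ → Unf) → Unf → Unf
  | s, var n => s n
  | s, lam t => lam (subst (lift s) t)
  | s, app t u => app (subst s t) (subst s u)
  | s, ptr t => ptr (subst s t)

theorem rename_rename (f g : ℕ → ℕ) (t : Unf) :
    (t.rename g).rename f = t.rename (fun i => f (g i)) := by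
  induction t generalizing f g with
  | var n => rfl
  | lam t ih => simp only [rename, ih, liftRen_comp]
  | app t u iht ihu => simp only [rename, iht, ihu]
  | ptr t ih => simp only [rename, ih]

theorem lift_var : lift var = var := by
  funext i; cases i <;> rfl

theorem lift_liftRen (s : ℕ → Unf) (f : ℕ → ℕ) :
    (fun i => lift s (liftRen f i)) = lift (fun i => s (f i)) :=
  scons_liftRen _ _ _

theorem rename_lift (f : ℕ → ℕ) (s : ℕ → Unf) :
    (fun i => (lift s i).rename (liftRen f)) = lift (fun i => (s i).rename f) := by
  funext i
  cases i with
  | zero => rfl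
  | succ i => simp only [lift, scons, rename_rename, liftRen]

theorem subst_rename (s : ℕ → Unf) (f : ℕ → ℕ) (t : Unf) :
    (t.rename f).subst s = t.subst (fun i => s (f i)) := by
  induction t generalizing s f with
  | var n => rfl
  | lam t ih => simp only [rename, subst, ih, lift_liftRen]
  | app t u iht ihu => simp only [rename, subst, iht, ihu]
  | ptr t ih => simp only [rename, subst, ih]

theorem rename_subst (f : ℕ → ℕ) (s : ℕ → Unf) (t : Unf) :
    (t.subst s).rename f = t.subst (fun i => (s i).rename f) := by
  induction t generalizing s f with
  | var n => rfl
  | lam t ih => simp only [rename, subst, ih, rename_lift]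
  | app t u iht ihu => simp only [rename, subst, iht, ihu]
  | ptr t ih => simp only [rename, subst, ih]

theorem subst_var (t : Unf) : t.subst var = t := by
  induction t with
  | var n => rfl
  | lam t ih => simp only [subst, lift_var, ih]
  | app t u iht ihu => simp only [subst, iht, ihu]
  | ptr t ih => simp only [subst, ih]

theorem subst_lift (r s : ℕ → Unf) :
    (fun i => (lift s i).subst (lift r)) = lift (fun i => (s i).subst r) := by
  funext i
  cases i with
  | zero => rfl
  | succ i => simp only [lift, scons, subst_rename, rename_subst]

theorem subst_scons_lift (a : Unf) (s : ℕ → Unf) :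
    (fun i => (lift s i).subst (scons a var)) = scons a s := by
  funext i
  cases i with
  | zero => rfl
  | succ i => simp only [lift, scons, subst_rename, subst_var]

/-! ### Reduction and readback of unfoldings -/

/-- Substitution of `ptr a` for the variable bound by a root abstraction, if there is one. -/
def beta : Unf → Unf → Option Unf
  | lam b, a => some (b.subst (scons (ptr a) var))
  | _, _ => none

/-- The leftmost-outermost step, which does not enter the arguments of `ptr`. -/
def step : Unf → Option (Kind × Unf)
  | var _ => none
  | ptr t => some (Kind.exp, t)
  | lam t => (step t).map (fun p => (p.1, lam p.2))
  | app t u =>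
    match beta t u with
    | some r => some (Kind.mul, r)
    | none =>
      match step t with
      | some p => some (p.1, app p.2 u)
      | none => (step u).map (fun p => (p.1, app t p.2))

/-- The term denoted by an unfolding. -/
def reify : Unf → Term
  | var n => .var n
  | lam t => .lam (reify t)
  | app t u => .app (reify t) (reify u)
  | ptr t => .es (.var 0) (reify t)

theorem reify_rename (f : ℕ → ℕ) (t : Unf) : (t.rename f).reify = t.reify.rename f := by
  induction t generalizing f with
  | var n => rfl
  | lam t ih => simp only [rename, reify, Term.rename, ih]
  | app t u iht ihu => simp only [rename, reify, Term.rename, iht, ihu]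
  | ptr t ih => simp only [rename, reify, Term.rename, ih, liftRen]

end Unf

/-! ### Evaluation and its commutation with renaming and substitution -/

/-- The unfolding of a term in an environment. -/
def Term.eval : (ℕ → Unf) → Term → Unf
  | ρ, .var n => ρ n
  | ρ, .lam t => .lam (Term.eval (Unf.lift ρ) t)
  | ρ, .app t u => .app (Term.eval ρ t) (Term.eval ρ u)
  | ρ, .es t u => Term.eval (scons (.ptr (Term.eval ρ u)) ρ) t

namespace Term

theorem eval_rename (ρ : ℕ → Unf) (f : ℕ → ℕ) (t : Term) :
    (t.rename f).eval ρ = t.eval (fun i => ρ (f i)) := by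
  induction t generalizing ρ f with
  | var n => rfl
  | lam t ih => simp only [rename, eval, ih, Unf.lift_liftRen]
  | app t u iht ihu => simp only [rename, eval, iht, ihu]
  | es t u iht ihu => simp only [rename, eval, iht, ihu, scons_liftRen]

theorem rename_eval (f : ℕ → ℕ) (ρ : ℕ → Unf) (t : Term) :
    (t.eval ρ).rename f = t.eval (fun i => (ρ i).rename f) := by
  induction t generalizing ρ f with
  | var n => rfl
  | lam t ih => simp only [eval, Unf.rename, ih, Unf.rename_lift]
  | app t u iht ihu => simp only [eval, Unf.rename, iht, ihu]
  | es t u iht ihu =>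
    simp only [eval, iht, comp_scons (fun a : Unf => a.rename f), Unf.rename, ihu]

theorem subst_eval (s ρ : ℕ → Unf) (t : Term) :
    (t.eval ρ).subst s = t.eval (fun i => (ρ i).subst s) := by
  induction t generalizing ρ s with
  | var n => rfl
  | lam t ih => simp only [eval, Unf.subst, ih, Unf.subst_lift]
  | app t u iht ihu => simp only [eval, Unf.subst, iht, ihu]
  | es t u iht ihu =>
    simp only [eval, iht, comp_scons (fun a : Unf => a.subst s), Unf.subst, ihu]

theorem eval_shift_one_lift (ρ : ℕ → Unf) (t : Term) :
    (t.shift 1).eval (Unf.lift ρ) = (t.eval ρ).rename Nat.succ := by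
  rw [shift, eval_rename, rename_eval]; rfl

theorem eval_shift_one_scons (a : Unf) (ρ : ℕ → Unf) (t : Term) :
    (t.shift 1).eval (scons a ρ) = t.eval ρ := by
  rw [shift, eval_rename]; rfl

end Term

/-! ### Structural equivalence is equality of unfoldings -/

/-- An ES only adds an entry to the environment, so each axiom reduces to comparing environments:
exchanged entries, an entry that is never read, or two equal entries. -/
theorem StructAx.eval_eq {t u : Term} (h : StructAx t u) (ρ : ℕ → Unf) : t.eval ρ = u.eval ρ := by
  cases h with
  | lam t u =>
    simp only [Term.eval, Term.eval_rename, Term.eval_shift_one_lift]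
    congr 2; funext i
    rcases i with _ | _ | i <;> rfl
  | appL t u w => simp only [Term.eval, Term.eval_shift_one_scons]
  | appR t u w => simp only [Term.eval, Term.eval_shift_one_scons]
  | com t u w =>
    simp only [Term.eval, Term.eval_rename, Term.eval_shift_one_scons]
    congr 1; funext i
    rcases i with _ | _ | i <;> rfl
  | comp t u w =>
    simp only [Term.eval, Term.eval_rename]
    congr 1; funext i
    rcases i with _ | i <;> rfl
  | gc t u => simp only [Term.eval, Term.eval_shift_one_scons]
  | dup s u =>
    simp only [Term.eval, Term.eval_rename, Term.eval_shift_one_scons]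
    congr 1; funext i
    rcases i with _ | _ | i <;> rfl

theorem Ctx.eval_plug_congr {t u : Term} (h : ∀ ρ, t.eval ρ = u.eval ρ) (C : Ctx) (ρ : ℕ → Unf) :
    (C.plug t).eval ρ = (C.plug u).eval ρ := by
  induction C generalizing ρ with
  | hole => exact h ρ
  | _ => simp only [Ctx.plug, Term.eval, *]

theorem StructEq.eval_eq {t u : Term} (h : StructEq t u) (ρ : ℕ → Unf) :
    t.eval ρ = u.eval ρ := by
  induction h generalizing ρ with
  | ax t u h => exact h.eval_eq ρ
  | refl t => rfl
  | symm t u _ ih => exact (ih ρ).symm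
  | trans t u w _ _ ih₁ ih₂ => exact (ih₁ ρ).trans (ih₂ ρ)
  | ctx C t u _ ih => exact Ctx.eval_plug_congr ih C ρ

namespace StructEq

theorem lam_congr {t u : Term} (h : StructEq t u) : StructEq (.lam t) (.lam u) :=
  ctx (.lam .hole) _ _ h

theorem app_congr {t t' u u' : Term} (ht : StructEq t t') (hu : StructEq u u') :
    StructEq (.app t u) (.app t' u') :=
  trans _ _ _ (ctx (.appL .hole u) _ _ ht) (ctx (.appR t' .hole) _ _ hu)

theorem es_congr {t t' u u' : Term} (ht : StructEq t t') (hu : StructEq u u') :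
    StructEq (.es t u) (.es t' u') :=
  trans _ _ _ (ctx (.esL .hole u) _ _ ht) (ctx (.esR t' .hole) _ _ hu)

/-- No axiom distributes an ES over both sides of an application; duplicating it first makes the two
one-sided axioms applicable. -/
theorem es_app (t u w : Term) :
    StructEq (.es (.app t u) w) (.app (.es t w) (.es u w)) := by
  -- Here `t` keeps the occurrences of `x` and misses `y`, while those in `u` are renamed as `y`;
  -- merging the two gives back `t u`.
  have hdup := StructAx.dup (.app (t.rename (liftRen Nat.succ)) (u.shift 1)) w
  have ht : (t.rename (liftRen Nat.succ)).rename Nat.pred = t := by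
    rw [Term.rename_rename]
    convert t.rename_id using 2
    funext i; cases i <;> rfl
  have hu : (u.shift 1).rename Nat.pred = u := by
    rw [Term.shift, Term.rename_rename]; exact u.rename_id
  rw [Term.rename, ht, hu] at hdup
  -- The inner ES goes to `t`, and the result is by definition `(Term.es t w).shift 1`, so the outer
  -- ES can go to `u`.
  refine trans _ _ _ (ax _ _ hdup) (trans _ _ _ ?_ (ax _ _ (StructAx.appR (.es t w) u w)))
  exact es_congr (ax _ _ (StructAx.appL _ _ _)) (refl _)

/-- An explicit substitution can be pushed to the occurrences of its variable. -/
theorem es_reify (n m : Unf) (f : ℕ → ℕ) :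
    StructEq (.es (n.reify.rename f) m.reify)
      (n.subst (fun i => scons (.ptr m) .var (f i))).reify := by
  induction n generalizing m f with
  | var i =>
    simp only [Unf.reify, Unf.subst, Term.rename]
    cases f i with
    | zero => exact refl _
    | succ j => exact ax _ _ (StructAx.gc (.var j) _)
  | lam n ih =>
    refine trans _ _ _ (ax _ _ (StructAx.lam _ _)) (lam_congr ?_)
    rw [Term.rename_rename, Term.shift]
    -- The statement carries a renaming `f` for this case: crossing the abstraction exchanges two
    -- binders, and the exchange is absorbed in `f`.
    have h := ih (m.rename Nat.succ) (fun i => swapRen (liftRen f i))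
    rw [Unf.reify_rename] at h
    convert h using 3
    funext i
    rcases i with _ | i
    · rfl
    · simp only [Unf.lift, scons, liftRen]
      cases f i <;> rfl
  | app n p ihn ihp => exact trans _ _ _ (es_app _ _ _) (app_congr (ihn m f) (ihp m f))
  | ptr n ih =>
    -- The body of a pointer is its own bound variable, so the outer ES does not occur in it and
    -- moves into the argument.
    exact trans _ _ _ (ax _ _ (StructAx.comp (.var 0) _ _)) (es_congr (refl _) (ih m f))

theorem reify_eval (t : Term) : StructEq t (t.eval Unf.var).reify := by
  induction t with
  | var n => exact refl _
  | lam t ih => simpa only [Term.eval, Unf.lift_var, Unf.reify] using lam_congr ih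
  | app t u iht ihu => exact app_congr iht ihu
  | es t u iht ihu =>
    refine trans _ _ _ (es_congr iht ihu) ?_
    have h := es_reify (t.eval Unf.var) (u.eval Unf.var) (fun i => i)
    rw [Term.rename_id, Term.subst_eval] at h
    exact h

theorem of_eval_eq {t u : Term} (h : t.eval Unf.var = u.eval Unf.var) : StructEq t u :=
  trans _ _ _ (reify_eval t) (h ▸ symm _ _ (reify_eval u))

end StructEq

/-! ### Redexes in an environment -/

/-- `Redex σ k C t u`: the term `t` rewrites to `u` with a step of kind `k` at the position `C`,
which is not inside the argument of an explicit substitution, where `σ` gives the contents of the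
free variables of `t` that are bound by surrounding explicit substitutions. -/
inductive Redex : (ℕ → Option Term) → Kind → Ctx → Term → Term → Prop
  | mul (σ : ℕ → Option Term) (L : Ctx) (b a : Term) : L.IsSubst →
      Redex σ .mul .hole (.app (L.plug (.lam b)) a) (L.plug (.es b (a.shift L.depth)))
  | exp (σ : ℕ → Option Term) (n : ℕ) (a : Term) : σ n = some a →
      Redex σ .exp .hole (.var n) a
  | lam (σ : ℕ → Option Term) (k : Kind) (C : Ctx) (t u : Term) :
      Redex (scons none (fun i => (σ i).map (Term.shift 1))) k C t u →
      Redex σ k (.lam C) (.lam t) (.lam u)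
  | appL (σ : ℕ → Option Term) (k : Kind) (C : Ctx) (t u r : Term) : Redex σ k C t u →
      Redex σ k (.appL C r) (.app t r) (.app u r)
  | appR (σ : ℕ → Option Term) (k : Kind) (C : Ctx) (t u r : Term) : Redex σ k C t u →
      Redex σ k (.appR r C) (.app r t) (.app r u)
  | esL (σ : ℕ → Option Term) (k : Kind) (C : Ctx) (t u a : Term) :
      Redex (scons (some (a.shift 1)) (fun i => (σ i).map (Term.shift 1))) k C t u →
      Redex σ k (.esL C a) (.es t a) (.es u a)

namespace Redex

theorem mul_plug (C : Ctx) (hC : C.OutsideES) (L : Ctx) (b a : Term) (hL : L.IsSubst)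
    (σ : ℕ → Option Term) :
    Redex σ .mul C (C.plug (.app (L.plug (.lam b)) a))
      (C.plug (L.plug (.es b (a.shift L.depth)))) := by
  induction C generalizing σ with
  | hole => exact mul σ L b a hL
  | lam C ih => exact lam _ _ _ _ _ (ih hC _)
  | appL C r ih => exact appL _ _ _ _ _ _ (ih hC _)
  | appR r C ih => exact appR _ _ _ _ _ _ (ih hC _)
  | esL C r ih => exact esL _ _ _ _ _ _ (ih hC _)
  | esR r C ih => exact hC.elim

/-- The ES that feeds the occurrence lies outside `E`, hence in `σ`; both its index and its content
are shifted by the binders crossed. -/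
theorem exp_plug (E : Ctx) (hE : E.OutsideES) (n : ℕ) (a : Term) (σ : ℕ → Option Term)
    (hσ : σ n = some a) :
    Redex σ .exp E (E.plug (.var (n + E.depth))) (E.plug (a.shift E.depth)) := by
  induction E generalizing σ n a with
  | hole => rw [Ctx.depth, Term.shift_zero]; exact exp σ n a hσ
  | appL E r ih => exact appL _ _ _ _ _ _ (ih hE n a σ hσ)
  | appR r E ih => exact appR _ _ _ _ _ _ (ih hE n a σ hσ)
  | esR r E ih => exact hE.elim
  | lam E ih =>
    have h := ih hE (n + 1) (a.shift 1) (scons none (fun i => (σ i).map (Term.shift 1)))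
      (by simp only [scons, hσ, Option.map_some])
    rw [Term.shift_shift, Nat.add_assoc, Nat.add_comm 1] at h
    exact lam _ _ _ _ _ h
  | esL E r ih =>
    have h := ih hE (n + 1) (a.shift 1)
      (scons (some (r.shift 1)) (fun i => (σ i).map (Term.shift 1)))
      (by simp only [scons, hσ, Option.map_some])
    rw [Term.shift_shift, Nat.add_assoc, Nat.add_comm 1] at h
    exact esL _ _ _ _ _ _ h

theorem exp_comp_plug (D E : Ctx) (a : Term) (h : (D.comp (.esL E a)).OutsideES)
    (σ : ℕ → Option Term) :
    Redex σ .exp (D.comp (.esL E a)) ((D.comp (.esL E a)).plug (.var E.depth))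
      ((D.comp (.esL E a)).plug (a.shift (E.depth + 1))) := by
  induction D generalizing σ with
  | hole =>
    refine esL _ _ _ _ _ _ ?_
    have h' := exp_plug E h 0 (a.shift 1)
      (scons (some (a.shift 1)) (fun i => (σ i).map (Term.shift 1))) rfl
    rwa [Term.shift_shift, Nat.zero_add, Nat.add_comm 1] at h'
  | lam D ih => exact lam _ _ _ _ _ (ih h _)
  | appL D r ih => exact appL _ _ _ _ _ _ (ih h _)
  | appR r D ih => exact appR _ _ _ _ _ _ (ih h _)
  | esL D r ih => exact esL _ _ _ _ _ _ (ih h _)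
  | esR r D ih => exact h.elim

theorem of_stepAt {k : Kind} {C : Ctx} {t u : Term} (hC : C.OutsideES) (h : StepAt k C t u)
    (σ : ℕ → Option Term) : Redex σ k C t u := by
  cases h with
  | mul _ L b a hL => exact mul_plug C hC L b a hL σ
  | exp D E a => exact exp_comp_plug D E a hC σ

theorem outsideES {σ : ℕ → Option Term} {k : Kind} {C : Ctx} {t u : Term}
    (h : Redex σ k C t u) : C.OutsideES := by
  induction h <;> trivial

theorem prefix_term {σ : ℕ → Option Term} {k : Kind} {C : Ctx} {t u : Term}
    (h : Redex σ k C t u) : C.Prefix t := by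
  induction h with
  | mul => exact ⟨_, rfl⟩
  | exp => exact ⟨_, rfl⟩
  | _ =>
    rename_i ih
    obtain ⟨v, rfl⟩ := ih
    exact ⟨v, rfl⟩

end Redex

theorem StepAt.comp {k : Kind} {C : Ctx} {t u : Term} (h : StepAt k C t u) (D : Ctx) :
    StepAt k (D.comp C) (D.plug t) (D.plug u) := by
  have plug_comp (D C : Ctx) (t : Term) : (D.comp C).plug t = D.plug (C.plug t) := by
    induction D <;> simp only [Ctx.comp, Ctx.plug, *]
  have comp_assoc (D C E : Ctx) : D.comp (C.comp E) = (D.comp C).comp E := by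
    induction D <;> simp only [Ctx.comp, *]
  cases h with
  | mul C L b a hL =>
    rw [← plug_comp, ← plug_comp]
    exact StepAt.mul _ L b a hL
  | exp C E a =>
    rw [← plug_comp, ← plug_comp, comp_assoc]
    exact StepAt.exp _ E a

/-- A redex in `σ` fails to be a genuine step only when its variable is bound in `σ`, outside the
term; with an empty `σ` this cannot happen. -/
theorem Redex.stepAt_or {σ : ℕ → Option Term} {k : Kind} {C : Ctx} {t u : Term}
    (h : Redex σ k C t u) :
    StepAt k C t u ∨ k = .exp ∧ ∃ n a, σ n = some a ∧
      t = C.plug (.var (n + C.depth)) ∧ u = C.plug (a.shift C.depth) := by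
  induction h with
  | mul σ L b a hL => exact .inl (StepAt.mul .hole L b a hL)
  | exp σ n a h => exact .inr ⟨rfl, n, a, h, rfl, a.shift_zero.symm⟩
  | lam σ k C t u _ ih =>
    rcases ih with h | ⟨rfl, n, a, hn, rfl, rfl⟩
    · exact .inl (h.comp (.lam .hole))
    · rcases n with _ | n
      · simp [scons] at hn
      · obtain ⟨a, ha, rfl⟩ := Option.map_eq_some_iff.1 hn
        refine .inr ⟨rfl, n, a, ha, ?_, ?_⟩
        · simp only [Ctx.plug, Ctx.depth, Nat.add_assoc, Nat.add_comm 1]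
        · simp only [Ctx.plug, Ctx.depth, Term.shift_shift, Nat.add_comm 1]
  | appL σ k C t u r _ ih =>
    rcases ih with h | ⟨rfl, n, a, hn, rfl, rfl⟩
    · exact .inl (h.comp (.appL .hole r))
    · exact .inr ⟨rfl, n, a, hn, rfl, rfl⟩
  | appR σ k C t u r _ ih =>
    rcases ih with h | ⟨rfl, n, a, hn, rfl, rfl⟩
    · exact .inl (h.comp (.appR r .hole))
    · exact .inr ⟨rfl, n, a, hn, rfl, rfl⟩
  | esL σ k C t u r _ ih =>
    rcases ih with h | ⟨rfl, n, a, hn, rfl, rfl⟩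
    · exact .inl (h.comp (.esL .hole r))
    · rcases n with _ | n
      -- The ES just crossed is the one that binds the variable, so the step becomes genuine here.
      · obtain rfl : r.shift 1 = a := Option.some.inj hn
        rw [Term.shift_shift, Nat.zero_add, Nat.add_comm 1]
        exact .inl (StepAt.exp .hole C r)
      · obtain ⟨a, ha, rfl⟩ := Option.map_eq_some_iff.1 hn
        refine .inr ⟨rfl, n, a, ha, ?_, ?_⟩
        · simp only [Ctx.plug, Ctx.depth, Nat.add_assoc, Nat.add_comm 1]
        · simp only [Ctx.plug, Ctx.depth, Term.shift_shift, Nat.add_comm 1]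

theorem redex_none_iff {k : Kind} {C : Ctx} {t u : Term} :
    Redex (fun _ => none) k C t u ↔ C.OutsideES ∧ StepAt k C t u := by
  refine ⟨fun h => ⟨h.outsideES, ?_⟩, fun h => Redex.of_stepAt h.1 h.2 _⟩
  rcases h.stepAt_or with h | ⟨_, _, _, h, _⟩
  · exact h
  · cases h

/-! ### The order on positions -/

namespace Ctx

theorem LeftOut.comp {C C' : Ctx} (h : C.LeftOut C') (D : Ctx) :
    (D.comp C).LeftOut (D.comp C') :=
  h.imp (OutIn.closure D C C') (LeftRight.closure D C C')

/-- Comparison of two contexts at the first node where they differ. -/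
def Before : Ctx → Ctx → Prop
  | hole, hole => False
  | hole, _ => True
  | lam C, lam C' => Before C C'
  | appL C _, appL C' _ => Before C C'
  | appL _ _, appR _ _ => True
  | appR _ C, appR _ C' => Before C C'
  | esL C _, esL C' _ => Before C C'
  | esL _ _, esR _ _ => True
  | esR _ C, esR _ C' => Before C C'
  | _, _ => False

theorem Before.comp {C C' : Ctx} (h : C.Before C') (D : Ctx) :
    (D.comp C).Before (D.comp C') := by
  induction D <;> simpa only [Ctx.comp, Before] using by assumption

theorem LeftOut.before {C C' : Ctx} (h : C.LeftOut C') : C.Before C' := by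
  rcases h with h | h
  · induction h with
    | root C hC => cases C <;> first | exact absurd rfl hC | trivial
    | closure D C C' _ ih => exact ih.comp D
  · induction h with
    | app => trivial
    | es => trivial
    | closure D C C' _ ih => exact ih.comp D

/-- `Before` is defined by recursion on both contexts, so asymmetry follows by induction; the
closure rules of the original orders have no such inversion. Asymmetry makes the leftmost-outermost
position unique. -/
theorem Before.asymm {C C' : Ctx} (h : C.Before C') : ¬ C'.Before C := by
  induction C generalizing C' with
  | hole => cases C' <;> simp_all [Before]
  | _ =>
    rename_i ih
    cases C' <;> simp_all [Before]

theorem LeftOut.asymm {C C' : Ctx} (h : C.LeftOut C') (h' : C'.LeftOut C) : False :=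
  h.before.asymm h'.before

/-- A multiplicative redex at the root decomposes in only one way, so its reduct is determined. -/
theorem IsSubst.plug_lam_inj {L L' : Ctx} {b b' : Term} (hL : L.IsSubst) (hL' : L'.IsSubst)
    (h : L.plug (.lam b) = L'.plug (.lam b')) : L = L' ∧ b = b' := by
  induction hL generalizing L' with
  | hole =>
    cases hL' with
    | hole => exact ⟨rfl, Term.lam.inj h⟩
    | esL L t hL' => cases h
  | esL L t _ ih =>
    cases hL' with
    | hole => cases h
    | esL L' t' hL' =>
      obtain ⟨h', rfl⟩ := Term.es.inj h
      obtain ⟨rfl, rfl⟩ := ih hL' h'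
      exact ⟨rfl, rfl⟩

end Ctx

/-! ### Leftmost-outermost steps of terms and of their unfoldings -/

/-- The environment `ρ` maps the variables listed in `σ` to pointers to their contents, and all
others to variables. -/
def Compat (σ : ℕ → Option Term) (ρ : ℕ → Unf) : Prop :=
  ∀ n, (∃ a, σ n = some a ∧ ρ n = .ptr (a.eval ρ)) ∨ σ n = none ∧ ∃ i, ρ n = .var i

theorem Compat.lam {σ : ℕ → Option Term} {ρ : ℕ → Unf} (h : Compat σ ρ) :
    Compat (scons none (fun i => (σ i).map (Term.shift 1))) (Unf.lift ρ) := by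
  rintro (_ | n)
  · exact .inr ⟨rfl, 0, rfl⟩
  · rcases h n with ⟨a, ha, hr⟩ | ⟨hn, i, hi⟩
    · refine .inl ⟨a.shift 1, by simp only [scons, ha, Option.map_some], ?_⟩
      rw [Term.eval_shift_one_lift]
      simp only [Unf.lift, scons, hr, Unf.rename]
    · exact .inr ⟨by simp only [scons, hn, Option.map_none], i + 1,
        by simp only [Unf.lift, scons, hi, Unf.rename]⟩

theorem Compat.es {σ : ℕ → Option Term} {ρ : ℕ → Unf} (h : Compat σ ρ) (a : Term) :
    Compat (scons (some (a.shift 1)) (fun i => (σ i).map (Term.shift 1)))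
      (scons (.ptr (a.eval ρ)) ρ) := by
  rintro (_ | n)
  · exact .inl ⟨_, rfl, by rw [Term.eval_shift_one_scons]; rfl⟩
  · rcases h n with ⟨b, hb, hr⟩ | ⟨hn, i, hi⟩
    · refine .inl ⟨b.shift 1, by simp only [scons, hb, Option.map_some], ?_⟩
      rw [Term.eval_shift_one_scons]
      exact hr
    · exact .inr ⟨by simp only [scons, hn, Option.map_none], i, hi⟩

/-- Evaluation turns `L` into environment entries, exposing the abstraction at the root: a step at
distance becomes an ordinary root step. The shifted argument does not read those entries. -/
theorem beta_eval_plug_lam {L : Ctx} (hL : L.IsSubst) (b a : Term) (ρ : ℕ → Unf) :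
    Unf.beta ((L.plug (.lam b)).eval ρ) (a.eval ρ) =
      some ((L.plug (.es b (a.shift L.depth))).eval ρ) := by
  induction hL generalizing ρ a with
  | hole =>
    simp only [Ctx.plug, Ctx.depth, Term.shift_zero, Term.eval, Unf.beta, Term.subst_eval,
      Unf.subst_scons_lift]
  | esL L t _ ih =>
    have h := ih (a.shift 1) (scons (.ptr (t.eval ρ)) ρ)
    rw [Term.eval_shift_one_scons, Term.shift_shift, Nat.add_comm 1] at h
    exact h

/-- `Compat` allows only pointers and variables in the environment, so a root abstraction of the
unfolding comes from the term itself, below ES only. -/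
theorem exists_plug_lam_of_eval_eq_lam {t : Term} {σ : ℕ → Option Term} {ρ : ℕ → Unf}
    (hρ : Compat σ ρ) {n : Unf} (h : t.eval ρ = .lam n) :
    ∃ (L : Ctx) (b : Term), L.IsSubst ∧ t = L.plug (.lam b) := by
  induction t generalizing σ ρ with
  | var i => rcases hρ i with ⟨a, _, hi⟩ | ⟨_, j, hi⟩ <;> rw [Term.eval, hi] at h <;> cases h
  | lam b => exact ⟨.hole, b, .hole, rfl⟩
  | app => cases h
  | es t u iht =>
    obtain ⟨L, b, hL, rfl⟩ := iht (hρ.es u) h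
    exact ⟨.esL L u, b, .esL _ _ hL, rfl⟩

/-- `LOAt σ k C t u`: the leftmost-outermost redex of `t` in `σ` has position `C`, kind `k` and
reduct `u`. -/
def LOAt (σ : ℕ → Option Term) (k : Kind) (C : Ctx) (t u : Term) : Prop :=
  Redex σ k C t u ∧ ∀ k' C' u', Redex σ k' C' t u' → (C' = C ∧ k' = k ∧ u' = u) ∨ C.LeftOut C'

/-- Both reductions search in the same order: the root, then the function, then the argument. An ES
is transparent to both, being merely an extension of `σ` and of `ρ`. -/
theorem loAt_or_normal (t : Term) {σ : ℕ → Option Term} {ρ : ℕ → Unf} (hρ : Compat σ ρ) :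
    ((t.eval ρ).step = none ∧ ∀ k C u, ¬ Redex σ k C t u) ∨
      ∃ k C u, LOAt σ k C t u ∧ (t.eval ρ).step = some (k, u.eval ρ) := by
  induction t generalizing σ ρ with
  | var n =>
    rcases hρ n with ⟨a, ha, hr⟩ | ⟨hn, i, hi⟩
    · refine .inr ⟨.exp, .hole, a, ⟨.exp _ _ _ ha, ?_⟩, by rw [Term.eval, hr, Unf.step]⟩
      rintro k' C' u' h
      cases h with
      | exp _ _ _ h => exact .inl ⟨rfl, rfl, Option.some.inj (h.symm.trans ha)⟩
    · refine .inl ⟨by rw [Term.eval, hi, Unf.step], ?_⟩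
      rintro k C u h
      cases h with
      | exp _ _ _ h => rw [hn] at h; cases h
  | lam t ih =>
    rcases ih hρ.lam with ⟨hs, hn⟩ | ⟨k, C, u, ⟨hr, hlo⟩, hs⟩
    · refine .inl ⟨by rw [Term.eval, Unf.step, hs, Option.map_none], ?_⟩
      rintro k C u h
      cases h with
      | lam _ _ C _ u h => exact hn _ _ _ h
    · refine .inr ⟨k, .lam C, .lam u, ⟨hr.lam, ?_⟩, by
        rw [Term.eval, Unf.step, hs, Option.map_some, Term.eval]⟩
      rintro k' C' u' h
      cases h with
      | lam _ _ C' _ u' h =>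
        rcases hlo _ _ _ h with ⟨rfl, rfl, rfl⟩ | h
        · exact .inl ⟨rfl, rfl, rfl⟩
        · exact .inr (h.comp (.lam .hole))
  | es t a ih =>
    rcases ih (hρ.es a) with ⟨hs, hn⟩ | ⟨k, C, u, ⟨hr, hlo⟩, hs⟩
    · refine .inl ⟨hs, ?_⟩
      rintro k C u h
      cases h with
      | esL _ _ C _ u _ h => exact hn _ _ _ h
    · refine .inr ⟨k, .esL C a, .es u a, ⟨hr.esL (a := a), ?_⟩, hs⟩
      rintro k' C' u' h
      cases h with
      | esL _ _ C' _ u' _ h =>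
        rcases hlo _ _ _ h with ⟨rfl, rfl, rfl⟩ | h
        · exact .inl ⟨rfl, rfl, rfl⟩
        · exact .inr (h.comp (.esL .hole a))
  | app t s iht ihs =>
    by_cases hlam : ∃ (L : Ctx) (b : Term), L.IsSubst ∧ t = L.plug (.lam b)
    · obtain ⟨L, b, hL, rfl⟩ := hlam
      refine .inr ⟨.mul, .hole, _, ⟨.mul σ L b s hL, ?_⟩, by
        rw [Term.eval, Unf.step, beta_eval_plug_lam hL]⟩
      rintro k' C' u' h
      generalize ht : Term.app (L.plug (.lam b)) s = t at h
      cases h with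
      | mul _ L' b' a' hL' =>
        obtain ⟨h, rfl⟩ := Term.app.inj ht
        obtain ⟨rfl, rfl⟩ := hL.plug_lam_inj hL' h
        exact .inl ⟨rfl, rfl, rfl⟩
      | exp => cases ht
      -- The root position is outside every other one.
      | _ => exact .inr (.inl (.root _ (by simp)))
    -- No root redex in the term means none in its unfolding, so both searches move on to the
    -- function.
    · have hbeta : Unf.beta (t.eval ρ) (s.eval ρ) = none := by
        cases h : t.eval ρ with
        | lam n => exact (hlam (exists_plug_lam_of_eval_eq_lam hρ h)).elim
        | _ => rfl
      rcases iht hρ with ⟨hs, hn⟩ | ⟨k, C, u, ⟨hr, hlo⟩, hs⟩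
      · rcases ihs hρ with ⟨hs', hn'⟩ | ⟨k, C, u, ⟨hr, hlo⟩, hs'⟩
        · refine .inl ⟨by simp only [Term.eval, Unf.step, hbeta, hs, hs', Option.map_none], ?_⟩
          rintro k C u h
          cases h with
          | mul _ L b a hL => exact hlam ⟨L, b, hL, rfl⟩
          | appL _ _ _ _ _ _ h => exact hn _ _ _ h
          | appR _ _ _ _ _ _ h => exact hn' _ _ _ h
        · refine .inr ⟨k, .appR t C, .app t u, ⟨hr.appR (r := t), ?_⟩, by
            simp only [Term.eval, Unf.step, hbeta, hs, hs', Option.map_some]⟩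
          rintro k' C' u' h
          cases h with
          | mul _ L b a hL => exact (hlam ⟨L, b, hL, rfl⟩).elim
          | appL _ _ _ _ _ _ h => exact (hn _ _ _ h).elim
          | appR _ _ C' _ u' _ h =>
            rcases hlo _ _ _ h with ⟨rfl, rfl, rfl⟩ | h
            · exact .inl ⟨rfl, rfl, rfl⟩
            · exact .inr (h.comp (.appR t .hole))
      · refine .inr ⟨k, .appL C s, .app u s, ⟨hr.appL (r := s), ?_⟩, by
          simp only [Term.eval, Unf.step, hbeta, hs]⟩
        rintro k' C' u' h
        cases h with
        | mul _ L b a hL => exact (hlam ⟨L, b, hL, rfl⟩).elim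
        | appL _ _ C' _ u' _ h =>
          rcases hlo _ _ _ h with ⟨rfl, rfl, rfl⟩ | h
          · exact .inl ⟨rfl, rfl, rfl⟩
          · exact .inr (h.comp (.appL .hole s))
        | appR _ _ C' _ u' _ h =>
          exact .inr (.inr (.app _ _ _ _ hr.prefix_term h.prefix_term))

/-! ### Transfer of steps between closed environments and unfoldings -/

theorem loStep_of_loAt {k : Kind} {C : Ctx} {t u : Term} (h : LOAt (fun _ => none) k C t u) :
    LOStep k t u := by
  obtain ⟨hC, hs⟩ := redex_none_iff.1 h.1
  refine ⟨C, ⟨⟨hC, k, u, hs⟩, ?_⟩, hs⟩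
  rintro C' ⟨hC', k', u', hs'⟩ hne
  exact (h.2 k' C' u' (redex_none_iff.2 ⟨hC', hs'⟩)).resolve_left fun h => hne h.1

theorem compat_none_var : Compat (fun _ => none) Unf.var := fun n => .inr ⟨rfl, n, rfl⟩

/-- The redex found by `loAt_or_normal` and the given one are both least, so by asymmetry they
coincide, and with them kind and reduct. -/
theorem LOStep.step_eval {k : Kind} {t u : Term} (h : LOStep k t u) :
    (t.eval Unf.var).step = some (k, u.eval Unf.var) := by
  obtain ⟨C, ⟨⟨hC, -⟩, hlo⟩, hs⟩ := h
  have hr := redex_none_iff.2 ⟨hC, hs⟩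
  rcases loAt_or_normal t compat_none_var with ⟨_, hn⟩ | ⟨k', C', u', ⟨hr', hlo'⟩, hs'⟩
  · exact (hn _ _ _ hr).elim
  · rcases hlo' _ _ _ hr with ⟨rfl, rfl, rfl⟩ | hlt
    · exact hs'
    · obtain ⟨hC', hstep⟩ := redex_none_iff.1 hr'
      by_cases hne : C' = C
      · subst hne; exact (hlt.asymm hlt).elim
      · exact (hlt.asymm (hlo C' ⟨hC', _, _, hstep⟩ hne)).elim

theorem exists_loStep_of_step_eval {k : Kind} {t : Term} {n : Unf}
    (h : (t.eval Unf.var).step = some (k, n)) : ∃ u, LOStep k t u ∧ u.eval Unf.var = n := by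
  rcases loAt_or_normal t compat_none_var with ⟨hs, _⟩ | ⟨k', C, u, hlo, hs⟩
  · rw [hs] at h; cases h
  · rw [hs] at h
    cases h
    exact ⟨u, loStep_of_loAt hlo, rfl⟩

end LSC

theorem mainTheorem3 (t u w : LSC.Term) (k : LSC.Kind)
    (htu : LSC.StructEq t u) (huw : LSC.LOStep k u w) :
    ∃ r : LSC.Term, LSC.LOStep k t r ∧ LSC.StructEq r w := by
  have h := huw.step_eval
  rw [← htu.eval_eq] at h
  obtain ⟨r, hr, hrw⟩ := LSC.exists_loStep_of_step_eval h
  exact ⟨r, hr, LSC.StructEq.of_eval_eq hrw⟩
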